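/- Let $0<\alpha<1$, $T>0$, let $E$ be a finite-dimensional real normed space (for instance $\mathbb R^d$), $f:E\to E$ locally Lipschitz, and $x_0\in E$. Let $x$ be a solution on $[0,T]$ of the Caputo initial value problem $${}_{\mathrm C}\mathcal D^{\alpha}_{0,t}x(t)=f(x(t)),\qquad x(0)=x_0,\qquad {}_{\mathrm C}\mathcal D^{\alpha}_{0,t}x(t)=\frac1{\Gamma(1-\alpha)}\int_0^t (t-t')^{-\alpha}x'(t')\,dt',$$ that is, $x$ is absolutely continuous on $[0,T]$, $x(0)=x_0$, and the equation holds for almost every $t\in(0,T)$. For a step $\delta t>0$ let $(X^{\delta t}_n)_{n\ge0}$ be the discrete solution given by the explicit difference equation $$X^{\delta t}_n=x_0+\frac{(n\,\delta t)^\alpha}{\Gamma(1+\alpha)}f(x_0)+\sum_{m=1}^{n-1}\frac{((n-m)\,\delta t)^\alpha}{\Gamma(1+\alpha)}\bigl(f(X^{\delta t}_m)-f(X^{\delta t}_{m-1})\bigr),\qquad n\ge 0 .$$ Then: 1. For every $t\in[0,T]$ the integrand below is integrable on $(0,t)$ and $$x(t)-x(0)=\int_0^t\frac{(t-t')^{\alpha-1}}{\Gamma(\alpha)}f(x(t'))\,dt'.$$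 2. The function $t\mapsto f(x(t))$ is absolutely continuous on $[0,T]$, and for every $t\in[0,T]$ the integrand below is integrable on $(0,t)$ and $$x(t)=x(0)+\frac{t^\alpha f(x(0))}{\Gamma(1+\alpha)}+\int_0^t\frac{(t-t')^\alpha}{\Gamma(1+\alpha)}\,\frac{d}{dt'}f(x(t'))\,dt'.\tag{$*$}$$ 3. (Convergence.) For every fixed $t\in(0,T]$, as $\delta t\to0$ with $t=n\,\delta t$ fixed (that is, $\delta t=t/n$, $n\to\infty$), $X^{\delta t}_n\to x(t)$, and $$\sum_{m=1}^{n-1}\frac{((n-m)\,\delta t)^\alpha}{\Gamma(1+\alpha)}\bigl(f(X^{\delta t}_m)-f(X^{\delta t}_{m-1})\bigr)\;\longrightarrow\;\int_0^t\frac{(t-t')^\alpha}{\Gamma(1+\alpha)}\,\frac{d}{dt'}f(x(t'))\,dt'.$$ 4. (Quadrature.) For grid values $g_0,\dots,g_n\in E$ put $$Q^{\delta t}_n[g]=\sum_{m=1}^{n}\delta t\,\frac{(n\,\delta t-m\,\delta t)^\alpha}{\Gamma(1+\alpha)}\,\frac{g_m-g_{m-1}}{\delta t}.$$ For all $\delta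 t>0$ and $n\ge0$, $$X^{\delta t}_n=x_0+\frac{(n\,\delta t)^\alpha}{\Gamma(1+\alpha)}f(x_0)+Q^{\delta t}_n\bigl[(f(X^{\delta t}_m))_m\bigr],$$ so that the scheme is $(*)$ with the integral replaced by this quadrature. The quadrature is convergent: for every $t>0$ and every absolutely continuous $g:[0,t]\to E$, $$Q^{t/n}_n\bigl[(g(mt/n))_m\bigr]\to\int_0^t\frac{(t-t')^\alpha}{\Gamma(1+\alpha)}\,g'(t')\,dt'\qquad(n\to\infty).$$ 5. (Fractional Adams form.) For all $\delta t>0$ and $n\ge0$, $$X^{\delta t}_n=x_0+\sum_{m=0}^{n-1}\left(\int_{m\,\delta t}^{(m+1)\,\delta t}\frac{(n\,\delta t-s)^{\alpha-1}}{\Gamma(\alpha)}\,ds\right)f(X^{\delta t}_m).$$ -/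

import Mathlib

open Filter Topology MeasureTheory

noncomputable section

/-- Caputo derivative of order `α ∈ (0,1)` at time `t`:
`Γ(1-α)⁻¹ ∫₀ᵗ (t-s)^(-α) x'(s) ds`. -/
def caputoDeriv {E : Type*} [NormedAddCommGroup E] [NormedSpace ℝ E]
    (α : ℝ) (x : ℝ → E) (t : ℝ) : E :=
  (1 / Real.Gamma (1 - α)) • ∫ s in (0 : ℝ)..t, (t - s) ^ (-α) • deriv x s

/-- `x` solves the Caputo initial value problem `D^α x(t) = f(x(t))`, `x(0) = x₀` on `[0,T]`:
it is absolutely continuous (so that `x'` exists almost everywhere, is integrable and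
integrates back to `x`), has the right initial value, and satisfies the equation for almost
every time. -/
structure IsCaputoSolution {E : Type*} [NormedAddCommGroup E] [NormedSpace ℝ E]
    (α : ℝ) (f : E → E) (x₀ : E) (T : ℝ) (x : ℝ → E) : Prop where
  absCont : AbsolutelyContinuousOnInterval x 0 T
  init : x 0 = x₀
  eqn : ∀ᵐ t ∂(volume.restrict (Set.Ioo 0 T)), caputoDeriv α x t = f (x t)

/-- The difference equation of piecewise constant integrablization with step `δ`. The value at
step `n` is given through the values at steps `0, …, n-1`; see `pwcScheme_eq` for the equation
without the bookkeeping. -/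
def pwcScheme {E : Type*} [NormedAddCommGroup E] [NormedSpace ℝ E]
    (α : ℝ) (f : E → E) (x₀ : E) (δ : ℝ) (n : ℕ) : E :=
  x₀ + ((n * δ) ^ α / Real.Gamma (1 + α)) • f x₀ +
    ∑ m : {m : ℕ // m ∈ Finset.Icc 1 (n - 1)},
      (((n - (m : ℕ)) * δ) ^ α / Real.Gamma (1 + α)) •
        (f (pwcScheme α f x₀ δ m) - f (pwcScheme α f x₀ δ (m - 1)))
termination_by n
decreasing_by
  all_goals
    have h := Finset.mem_Icc.1 m.2
    omega

/-- The history sum `∑_{m=1}^{n-1} ((n-m)δ)^α / Γ(1+α) • (g_m - g_{m-1})`. -/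
def historySum {E : Type*} [NormedAddCommGroup E] [NormedSpace ℝ E]
    (α δ : ℝ) (n : ℕ) (g : ℕ → E) : E :=
  ∑ m ∈ Finset.Icc 1 (n - 1),
    (((n - m) * δ) ^ α / Real.Gamma (1 + α)) • (g m - g (m - 1))

theorem pwcScheme_eq {E : Type*} [NormedAddCommGroup E] [NormedSpace ℝ E]
    (α : ℝ) (f : E → E) (x₀ : E) (δ : ℝ) (n : ℕ) :
    pwcScheme α f x₀ δ n = x₀ + ((n * δ) ^ α / Real.Gamma (1 + α)) • f x₀ +
      historySum α δ n (fun m => f (pwcScheme α f x₀ δ m)) := by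
  rw [pwcScheme, historySum]
  congr 1
  exact Finset.sum_coe_sort (Finset.Icc 1 (n - 1)) (fun m : ℕ =>
    (((n - m : ℝ) * δ) ^ α / Real.Gamma (1 + α)) •
      (f (pwcScheme α f x₀ δ m) - f (pwcScheme α f x₀ δ (m - 1))))

/-- The quadrature of `∫₀^{nδ} (nδ-s)^α / Γ(1+α) • g'(s) ds` on the grid `mδ`, with nodes
`s = mδ` for `1 ≤ m ≤ n` and the derivative `g'(mδ)` replaced by the backward difference
quotient of the grid values `g_m` (the node `m = n` contributes nothing, as the kernel vanishes
there). -/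
def riemannQuad {E : Type*} [NormedAddCommGroup E] [NormedSpace ℝ E]
    (α δ : ℝ) (n : ℕ) (g : ℕ → E) : E :=
  ∑ m ∈ Finset.Icc 1 n,
    (δ * ((n * δ - m * δ) ^ α / Real.Gamma (1 + α))) • (δ⁻¹ • (g m - g (m - 1)))

end

/-! Applying the fractional integral of order `α` to the equation and swapping integrals leaves `∫
x'`, because the composed kernel is a Beta integral with constant value `Γ(α)Γ(1-α)`
(`fracIntegral_abel`). Integrating by parts against `(t-s)^α / Γ(1+α)`, which vanishes at `s = t`,
gives (∗). The quadrature converges because this kernel is `α`-Hölder: the error is at most `δ^α /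
Γ(1+α)` times `∫ ‖g'‖`.

Summation by parts (`smul_add_riemannQuad`) turns the scheme into the rectangle rule for the
fractional integral equation, with exact kernel integrals as weights. The error then satisfies a
discrete Volterra inequality with nonnegative weights. Measured against `exp (l * t)`, the history
operator has norm at most `L * l^(-α)` (`sum_fracWeight_mul_exp_le`), which is at most `1/2` for
large `l`; this replaces a fractional Gronwall inequality. Strong induction keeps the discrete
solution in the ball where `L` is valid (`norm_pwcScheme_sub_le`). The history sum converges because
it is the scheme minus terms that converge. -/

theorem LipschitzOnWith.comp_absolutelyContinuousOnInterval {X Y : Type*} [PseudoMetricSpace X]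
    [PseudoMetricSpace Y] {K : NNReal} {f : X → Y} {s : Set X} {g : ℝ → X} {a b : ℝ}
    (hf : LipschitzOnWith K f s) (hg : AbsolutelyContinuousOnInterval g a b)
    (hs : Set.MapsTo g (Set.uIcc a b) s) :
    AbsolutelyContinuousOnInterval (fun r => f (g r)) a b := by
  unfold AbsolutelyContinuousOnInterval at hg ⊢
  refine squeeze_zero' (.of_forall fun _ => Finset.sum_nonneg fun _ _ => dist_nonneg) ?_
    (by simpa using hg.const_mul (K : ℝ))
  filter_upwards [mem_inf_of_right (mem_principal_self _)] with I hI
  rw [Finset.mul_sum]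
  exact Finset.sum_le_sum fun i hi =>
    hf.dist_le_mul _ (hs (hI.1 i hi).1) _ (hs (hI.1 i hi).2)

/-! ### Calculus of absolutely continuous functions in finite dimensions. -/

namespace AbsolutelyContinuousOnInterval

variable {E : Type*} [NormedAddCommGroup E] [NormedSpace ℝ E] {g : ℝ → E} {a b : ℝ}

theorem clm_comp {F : Type*} [NormedAddCommGroup F] [NormedSpace ℝ F] (φ : E →L[ℝ] F)
    (hg : AbsolutelyContinuousOnInterval g a b) :
    AbsolutelyContinuousOnInterval (fun r => φ (g r)) a b :=
  (φ.lipschitz.lipschitzOnWith (s := Set.univ)).comp_absolutelyContinuousOnInterval hg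
    (Set.mapsTo_univ _ _)

variable [FiniteDimensional ℝ E]

theorem ae_hasDerivAt (hg : AbsolutelyContinuousOnInterval g a b) :
    ∀ᵐ r, r ∈ Set.uIcc a b → HasDerivAt g (deriv g r) r := by
  filter_upwards [hg.boundedVariationOn.ae_differentiableAt_of_mem_uIcc] with r hr hrm
  exact (hr hrm).hasDerivAt

/-- Reduces the vector-valued fundamental theorem to the real one: `φ` commutes with the derivative
almost everywhere. -/
theorem intervalIntegrable_deriv_clm_comp (φ : E →L[ℝ] ℝ)
    (hg : AbsolutelyContinuousOnInterval g a b) :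
    IntervalIntegrable (fun r => φ (deriv g r)) volume a b ∧
      ∫ r in a..b, φ (deriv g r) = φ (g b) - φ (g a) := by
  have hφ := hg.clm_comp φ
  have hae : ∀ᵐ r, r ∈ Set.uIcc a b → deriv (fun u => φ (g u)) r = φ (deriv g r) := by
    filter_upwards [hg.ae_hasDerivAt] with r hr hrm
    exact (φ.hasFDerivAt.comp_hasDerivAt r (hr hrm)).deriv
  constructor
  · refine hφ.intervalIntegrable_deriv.congr_ae ?_
    rw [Filter.EventuallyEq, ae_restrict_iff' measurableSet_uIoc]
    filter_upwards [hae] with r hr hrm using hr (Set.uIoc_subset_uIcc hrm)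
  · rw [← hφ.integral_deriv_eq_sub]
    refine intervalIntegral.integral_congr_ae ?_
    filter_upwards [hae] with r hr hrm using (hr (Set.uIoc_subset_uIcc hrm)).symm

/-- The derivative of a finite-dimensional absolutely continuous function is integrable. -/
theorem intervalIntegrable_deriv' (hg : AbsolutelyContinuousOnInterval g a b) :
    IntervalIntegrable (deriv g) volume a b := by
  let B := Module.finBasis ℝ E
  have h : deriv g = ∑ i, fun r =>
      (LinearMap.toContinuousLinearMap (B.coord i)) (deriv g r) • B i := by
    funext r
    simp [B.sum_repr]
  rw [h]
  exact IntervalIntegrable.sum _ fun i _ =>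
    (hg.intervalIntegrable_deriv_clm_comp (LinearMap.toContinuousLinearMap
      (B.coord i))).1.smul_continuousOn continuousOn_const

/-- The fundamental theorem of calculus in finite dimensions. -/
theorem integral_deriv_eq_sub' (hg : AbsolutelyContinuousOnInterval g a b) :
    ∫ r in a..b, deriv g r = g b - g a := by
  let B := Module.finBasis ℝ E
  refine B.ext_elem fun i => ?_
  have h := (hg.intervalIntegrable_deriv_clm_comp (LinearMap.toContinuousLinearMap (B.coord i))).2
  rw [ContinuousLinearMap.intervalIntegral_comp_comm _ hg.intervalIntegrable_deriv'] at h
  simpa using h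

/-- Integration by parts for a scalar against a vector-valued function. -/
theorem integral_smul_deriv_eq_deriv_smul {k : ℝ → ℝ} (hk : AbsolutelyContinuousOnInterval k a b)
    (hg : AbsolutelyContinuousOnInterval g a b) :
    ∫ r in a..b, k r • deriv g r =
      k b • g b - k a • g a - ∫ r in a..b, deriv k r • g r := by
  have h1 : IntervalIntegrable (fun r => k r • deriv g r) volume a b :=
    hg.intervalIntegrable_deriv'.continuousOn_smul hk.continuousOn
  have h2 : IntervalIntegrable (fun r => deriv k r • g r) volume a b :=
    hk.intervalIntegrable_deriv.smul_continuousOn hg.continuousOn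
  rw [eq_sub_iff_add_eq, ← intervalIntegral.integral_add h1 h2]
  have := (hk.fun_smul hg).integral_deriv_eq_sub'
  rw [← this]
  refine intervalIntegral.integral_congr_ae ?_
  filter_upwards [hk.ae_hasDerivAt, hg.ae_hasDerivAt] with r h3 h4 hrm
  have hr := Set.uIoc_subset_uIcc hrm
  exact ((h3 hr).smul (h4 hr)).deriv.symm

end AbsolutelyContinuousOnInterval

/-- Subadditivity of the power; it supplies the Hölder bound on the kernel. -/
theorem rpow_sub_rpow_le_rpow_sub {α a b : ℝ} (hα₀ : 0 ≤ α) (hα₁ : α ≤ 1) (hb : 0 ≤ b) (hab : b ≤ a) :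
    a ^ α - b ^ α ≤ (a - b) ^ α := by
  have h := Real.rpow_add_le_add_rpow (sub_nonneg.2 hab) hb hα₀ hα₁
  rw [sub_add_cancel] at h
  linarith

/-! ### The fractional kernel and its primitive. -/

section kernel

variable {α : ℝ}

theorem intervalIntegrable_fracKernel (hα : 0 < α) (t a b : ℝ) :
    IntervalIntegrable (fun s => (t - s) ^ (α - 1) / Real.Gamma α) volume a b := by
  have h := (intervalIntegral.intervalIntegrable_rpow' (a := t - a) (b := t - b) (r := α - 1)
    (by linarith)).comp_sub_left t
  simp only [sub_sub_cancel] at h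
  exact h.div_const _

theorem integral_fracKernel (hα : 0 < α) (t a b : ℝ) :
    ∫ s in a..b, (t - s) ^ (α - 1) / Real.Gamma α =
      ((t - a) ^ α - (t - b) ^ α) / Real.Gamma (1 + α) := by
  rw [intervalIntegral.integral_div,
    intervalIntegral.integral_comp_sub_left (fun s => s ^ (α - 1)) t,
    integral_rpow (Or.inl (by linarith)), sub_add_cancel, add_comm 1 α,
    Real.Gamma_add_one hα.ne', div_div]

theorem hasDerivAt_fracPrimitive (hα : 0 < α) {t s : ℝ} (hs : s < t) :
    HasDerivAt (fun r => (t - r) ^ α / Real.Gamma (1 + α))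
      (-((t - s) ^ (α - 1) / Real.Gamma α)) s := by
  have h := (((hasDerivAt_id s).const_sub t).rpow_const (p := α)
    (Or.inl (sub_pos.2 hs).ne')).div_const (Real.Gamma (1 + α))
  convert! h using 1
  rw [add_comm 1 α, Real.Gamma_add_one hα.ne']
  simp
  field_simp

/-- A constant minus the indefinite integral of an integrable kernel, so a singularity of the
derivative at `t` does no harm. -/
theorem absolutelyContinuousOnInterval_fracPrimitive (hα : 0 < α) (t a b : ℝ) :
    AbsolutelyContinuousOnInterval (fun r => (t - r) ^ α / Real.Gamma (1 + α)) a b := by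
  have h1 := (intervalIntegrable_fracKernel hα t a
    b).absolutelyContinuousOnInterval_intervalIntegral (Set.left_mem_uIcc)
  have h2 : AbsolutelyContinuousOnInterval
      (fun _ : ℝ => (t - a) ^ α / Real.Gamma (1 + α)) a b :=
    (LipschitzWith.const _).lipschitzOnWith.absolutelyContinuousOnInterval
  convert! h2.fun_sub h1 using 2 with r
  rw [integral_fracKernel hα]
  ring

/-- Integration by parts of the fractional integral. -/
theorem integral_fracPrimitive_smul_deriv {E : Type*} [NormedAddCommGroup E] [NormedSpace ℝ E]
    [FiniteDimensional ℝ E] (hα : 0 < α) {t : ℝ} (ht : 0 ≤ t) {g : ℝ → E}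
    (hg : AbsolutelyContinuousOnInterval g 0 t) :
    ∫ s in (0 : ℝ)..t, ((t - s) ^ α / Real.Gamma (1 + α)) • deriv g s =
      (∫ s in (0 : ℝ)..t, ((t - s) ^ (α - 1) / Real.Gamma α) • g s) -
        (t ^ α / Real.Gamma (1 + α)) • g 0 := by
  rw [(absolutelyContinuousOnInterval_fracPrimitive hα t 0
    t).integral_smul_deriv_eq_deriv_smul hg]
  have h : ∫ s in (0 : ℝ)..t, deriv (fun r => (t - r) ^ α / Real.Gamma (1 + α)) s • g s =
      ∫ s in (0 : ℝ)..t, -(((t - s) ^ (α - 1) / Real.Gamma α) • g s) := by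
    refine intervalIntegral.integral_congr_ae ?_
    filter_upwards [Measure.ae_ne volume t] with s hs hsm
    rw [Set.uIoc_of_le ht] at hsm
    rw [(hasDerivAt_fracPrimitive hα (lt_of_le_of_ne hsm.2 hs)).deriv, neg_smul]
  rw [h, intervalIntegral.integral_neg]
  simp [Real.zero_rpow hα.ne']
  abel

end kernel

/-! ### Abel inversion and the fractional integral equation. -/

section abel

variable {α : ℝ}

/-- A scaled Beta integral whose parameters `1 - α` and `α` sum to `1`: the power of `t - s` has
exponent `0` and the denominator is `Γ(1) = 1`. -/
theorem integral_fracKernel_mul_rpow (hα₀ : 0 < α) (hα₁ : α < 1) {s t : ℝ} (hst : s < t) :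
    ∫ u in s..t, (t - u) ^ (α - 1) * (u - s) ^ (-α) = Real.Gamma α * Real.Gamma (1 - α) := by
  have hsub := intervalIntegral.integral_comp_sub_right (a := s) (b := t)
    (fun v : ℝ => (t - s - v) ^ (α - 1) * v ^ (-α)) s
  rw [sub_self] at hsub
  simp only [sub_sub_sub_cancel_right] at hsub
  rw [hsub]
  have h := Complex.betaIntegral_scaled (1 - α : ℝ) (α : ℝ) (sub_pos.2 hst)
  rw [Complex.betaIntegral_eq_Gamma_mul_div _ _ (by simpa using hα₁) (by simpa using hα₀)] at h
  rw [← Complex.ofReal_add, Complex.Gamma_ofReal, Complex.Gamma_ofReal, Complex.Gamma_ofReal,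
    sub_add_cancel, Real.Gamma_one, Complex.ofReal_one, sub_self, Complex.cpow_zero, one_mul,
    div_one, ← Complex.ofReal_mul] at h
  rw [← Complex.ofReal_inj, mul_comm (Real.Gamma α), ← h, ← intervalIntegral.integral_ofReal]
  refine intervalIntegral.integral_congr fun v hv => ?_
  rw [Set.uIcc_of_le (sub_pos.2 hst).le] at hv
  rw [Complex.ofReal_mul, Complex.ofReal_cpow hv.1, Complex.ofReal_cpow (sub_nonneg.2 hv.2),
    mul_comm]
  congr 2
  · push_cast; ring
  · push_cast; ring
  · push_cast; ring

/-- The kernel of the iterated fractional integral. -/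
noncomputable def abelKernel (α t u s : ℝ) : ℝ :=
  (Set.Ioi s).indicator (fun u => (t - u) ^ (α - 1) * (u - s) ^ (-α)) u

theorem measurable_abelKernel (α t : ℝ) :
    Measurable (fun p : ℝ × ℝ => abelKernel α t p.1 p.2) := by
  have h : (fun p : ℝ × ℝ => abelKernel α t p.1 p.2) = {p : ℝ × ℝ | p.2 < p.1}.indicator
      (fun p => (t - p.1) ^ (α - 1) * (p.1 - p.2) ^ (-α)) := by
    funext p
    simp [abelKernel, Set.indicator]
  rw [h]
  refine Measurable.indicator (by fun_prop) (measurableSet_lt measurable_snd measurable_fst)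

theorem abelKernel_nonneg {t u s : ℝ} (hu : u ≤ t) : 0 ≤ abelKernel α t u s := by
  refine Set.indicator_apply_nonneg fun h => ?_
  have h' : s < u := h
  have := sub_nonneg.2 hu
  have := (sub_pos.2 h').le
  positivity

theorem integral_abelKernel (hα₀ : 0 < α) (hα₁ : α < 1) {s t : ℝ} (hs : 0 ≤ s) (hst : s < t) :
    Integrable (fun u => abelKernel α t u s) (volume.restrict (Set.Ioc 0 t)) ∧
      ∫ u in Set.Ioc 0 t, abelKernel α t u s = Real.Gamma α * Real.Gamma (1 - α) := by
  have h : ∫ u in Set.Ioc 0 t, abelKernel α t u s = Real.Gamma α * Real.Gamma (1 - α) := by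
    have hset : Set.Ioc 0 t ∩ Set.Ioi s = Set.Ioc s t := by
      ext u
      simp only [Set.mem_inter_iff, Set.mem_Ioc, Set.mem_Ioi]
      constructor
      · exact fun h => ⟨h.2, h.1.2⟩
      · exact fun h => ⟨⟨hs.trans_lt h.1, h.2⟩, h.1⟩
    simp only [abelKernel]
    rw [setIntegral_indicator measurableSet_Ioi, hset, ← intervalIntegral.integral_of_le hst.le,
      integral_fracKernel_mul_rpow hα₀ hα₁ hst]
  -- A non-integrable function has integral `0` by convention, so the nonzero value already proves
  -- integrability.
  refine ⟨Integrable.of_integral_ne_zero ?_, h⟩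
  rw [h]
  exact (mul_pos (Real.Gamma_pos_of_pos hα₀) (Real.Gamma_pos_of_pos (sub_pos.2 hα₁))).ne'

variable {E : Type*} [NormedAddCommGroup E] [NormedSpace ℝ E]

/-- Tonelli: the kernel is nonnegative with constant mass in `u`, so the inner integral of the norm
is a multiple of `‖y s‖`. -/
theorem integrable_abelKernel_smul (hα₀ : 0 < α) (hα₁ : α < 1) {t : ℝ} {y : ℝ → E}
    (hy : IntegrableOn y (Set.Ioc 0 t)) :
    Integrable (Function.uncurry fun u s => abelKernel α t u s • y s)
      ((volume.restrict (Set.Ioc 0 t)).prod (volume.restrict (Set.Ioc 0 t))) := by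
  have hae : ∀ᵐ s ∂(volume.restrict (Set.Ioc 0 t)), 0 ≤ s ∧ s < t := by
    rw [ae_restrict_iff' measurableSet_Ioc]
    filter_upwards [Measure.ae_ne volume t] with s hs hsm
      using ⟨hsm.1.le, lt_of_le_of_ne hsm.2 hs⟩
  have hmeas : AEStronglyMeasurable (Function.uncurry fun u s => abelKernel α t u s • y s)
      ((volume.restrict (Set.Ioc 0 t)).prod (volume.restrict (Set.Ioc 0 t))) :=
    (measurable_abelKernel α t).aestronglyMeasurable.smul hy.aestronglyMeasurable.comp_snd
  rw [integrable_prod_iff' hmeas]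
  constructor
  · filter_upwards [hae] with s hs
    exact (integral_abelKernel hα₀ hα₁ hs.1 hs.2).1.smul_const (y s)
  · refine (hy.norm.const_mul (Real.Gamma α * Real.Gamma (1 - α))).congr ?_
    filter_upwards [hae] with s hs
    rw [← (integral_abelKernel hα₀ hα₁ hs.1 hs.2).2, ← integral_mul_const]
    refine setIntegral_congr_fun measurableSet_Ioc fun u hu => ?_
    simp [norm_smul, abs_of_nonneg (abelKernel_nonneg hu.2)]

/-- Abel's inversion: the fractional integral of order `α` undoes the Caputo derivative. -/
theorem fracIntegral_abel [CompleteSpace E] (hα₀ : 0 < α) (hα₁ : α < 1) {t : ℝ} (ht : 0 ≤ t)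
    {y : ℝ → E} (hy : IntervalIntegrable y volume 0 t) :
    ∫ u in (0 : ℝ)..t, ((t - u) ^ (α - 1) / Real.Gamma α) •
      (1 / Real.Gamma (1 - α)) • ∫ s in (0 : ℝ)..u, (u - s) ^ (-α) • y s =
    ∫ s in (0 : ℝ)..t, y s := by
  have hG := (mul_pos (Real.Gamma_pos_of_pos hα₀) (Real.Gamma_pos_of_pos (sub_pos.2 hα₁))).ne'
  rw [intervalIntegrable_iff_integrableOn_Ioc_of_le ht] at hy
  have hswap := integral_integral_swap (integrable_abelKernel_smul hα₀ hα₁ hy)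
  have hright : ∫ s in Set.Ioc 0 t, ∫ u in Set.Ioc 0 t, abelKernel α t u s • y s =
      (Real.Gamma α * Real.Gamma (1 - α)) • ∫ s in Set.Ioc 0 t, y s := by
    rw [← integral_smul]
    refine integral_congr_ae ?_
    rw [Filter.EventuallyEq, ae_restrict_iff' measurableSet_Ioc]
    filter_upwards [Measure.ae_ne volume t] with s hs hsm
    rw [integral_smul_const,
      (integral_abelKernel hα₀ hα₁ hsm.1.le (lt_of_le_of_ne hsm.2 hs)).2]
  have hleft : ∀ u ∈ Set.Ioc 0 t, ∫ s in Set.Ioc 0 t, abelKernel α t u s • y s =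
      (t - u) ^ (α - 1) • ∫ s in (0 : ℝ)..u, (u - s) ^ (-α) • y s := by
    intro u hu
    have hset : Set.Ioc 0 t ∩ Set.Iio u = Set.Ioo 0 u := by
      ext s
      simp only [Set.mem_inter_iff, Set.mem_Ioc, Set.mem_Iio, Set.mem_Ioo]
      exact ⟨fun h => ⟨h.1.1, h.2⟩, fun h => ⟨⟨h.1, (h.2.trans_le hu.2).le⟩, h.2⟩⟩
    have hfun : (fun s => abelKernel α t u s • y s) = (Set.Iio u).indicator
        (fun s => (t - u) ^ (α - 1) • (u - s) ^ (-α) • y s) := by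
      funext s
      by_cases hs : s < u <;> simp [abelKernel, Set.indicator, hs, mul_smul]
    rw [hfun, setIntegral_indicator measurableSet_Iio, hset, integral_smul,
      ← integral_Ioc_eq_integral_Ioo, ← intervalIntegral.integral_of_le hu.1.le]
  rw [hright, setIntegral_congr_fun measurableSet_Ioc hleft] at hswap
  rw [intervalIntegral.integral_of_le ht, intervalIntegral.integral_of_le ht,
    ← inv_smul_smul₀ hG (∫ s in Set.Ioc 0 t, y s), ← hswap, ← integral_smul]
  refine setIntegral_congr_fun measurableSet_Ioc fun u _ => ?_
  simp only [smul_smul]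
  congr 1
  field_simp

/-- A solution of the Caputo problem solves the fractional integral equation. -/
theorem IsCaputoSolution.sub_eq_fracIntegral [FiniteDimensional ℝ E] (hα₀ : 0 < α)
    (hα₁ : α < 1) {f : E → E} {x₀ : E} {T : ℝ} {x : ℝ → E} (hx : IsCaputoSolution α f x₀ T x)
    {t : ℝ} (ht : t ∈ Set.Icc 0 T) :
    x t - x 0 = ∫ s in (0 : ℝ)..t, ((t - s) ^ (α - 1) / Real.Gamma α) • f (x s) := by
  have hT := ht.1.trans ht.2
  have hac : AbsolutelyContinuousOnInterval x 0 t := hx.absCont.mono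
    (by rw [Set.uIcc_of_le ht.1, Set.uIcc_of_le hT]; exact Set.Icc_subset_Icc_right ht.2)
  have : CompleteSpace E := FiniteDimensional.complete ℝ E
  rw [← hac.integral_deriv_eq_sub', ← fracIntegral_abel hα₀ hα₁ ht.1 hac.intervalIntegrable_deriv']
  refine intervalIntegral.integral_congr_ae ?_
  have heq := hx.eqn
  rw [ae_restrict_iff' measurableSet_Ioo] at heq
  filter_upwards [heq, Measure.ae_ne volume t] with s hs hst hsm
  rw [Set.uIoc_of_le ht.1] at hsm
  rw [← hs ⟨hsm.1, (lt_of_le_of_ne hsm.2 hst).trans_le ht.2⟩, caputoDeriv]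

end abel

/-! ### Quadrature and Adams forms of the scheme, and convergence of the quadrature. -/

section scheme

variable {E : Type*} [NormedAddCommGroup E] [NormedSpace ℝ E] {α : ℝ}

theorem historySum_eq_riemannQuad (hα : 0 < α) {δ : ℝ} (hδ : 0 < δ) (n : ℕ) (g : ℕ → E) :
    historySum α δ n g = riemannQuad α δ n g := by
  have hterm : ∀ m : ℕ, (δ * ((n * δ - m * δ) ^ α / Real.Gamma (1 + α))) •
      (δ⁻¹ • (g m - g (m - 1))) =
      (((n - m) * δ) ^ α / Real.Gamma (1 + α)) • (g m - g (m - 1)) := fun m => by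
    rw [smul_smul, ← sub_mul]
    congr 1
    field_simp
  simp only [historySum, riemannQuad, hterm]
  cases n with
  | zero => simp
  | succ n =>
    -- The extra node `m = n` has weight `0 ^ α = 0`.
    rw [Finset.sum_Icc_succ_top (by omega)]
    simp [Real.zero_rpow hα.ne']

theorem riemannQuad_eq_sum_range {δ : ℝ} (hδ : 0 < δ) (n : ℕ) (g : ℕ → E) :
    riemannQuad α δ n g = ∑ m ∈ Finset.range n,
      ((n * δ - (m + 1 : ℕ) * δ) ^ α / Real.Gamma (1 + α)) • (g (m + 1) - g m) := by
  rw [riemannQuad, ← Finset.Ico_add_one_right_eq_Icc, Finset.sum_Ico_eq_sum_range]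
  refine Finset.sum_congr rfl fun m _ => ?_
  rw [smul_smul, add_comm 1 m, Nat.add_sub_cancel]
  congr 1
  field_simp

/-- Summation by parts: the quadrature in terms of the increments of the kernel. -/
theorem smul_add_riemannQuad (hα : 0 < α) {δ : ℝ} (hδ : 0 < δ) (n : ℕ) (g : ℕ → E) :
    ((n * δ) ^ α / Real.Gamma (1 + α)) • g 0 + riemannQuad α δ n g =
      ∑ m ∈ Finset.range n,
        (∫ s in (m * δ)..((m + 1) * δ), (n * δ - s) ^ (α - 1) / Real.Gamma α) • g m := by
  rw [riemannQuad_eq_sum_range hδ]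
  let c : ℕ → ℝ := fun m => (n * δ - m * δ) ^ α / Real.Gamma (1 + α)
  -- Telescoping `c m • g m`, with `c n = 0`, is the summation by parts.
  have h := Finset.sum_range_sub (fun m => c m • g m) n
  have hn : c n = 0 := by simp [c, Real.zero_rpow hα.ne']
  have h0 : c 0 = (n * δ) ^ α / Real.Gamma (1 + α) := by simp [c]
  simp only [hn, zero_smul, zero_sub, h0] at h
  rw [← neg_eq_iff_eq_neg.2 h, ← sub_eq_neg_add, sub_eq_iff_eq_add, ← Finset.sum_add_distrib]
  refine Finset.sum_congr rfl fun m _ => ?_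
  rw [integral_fracKernel hα, sub_div]
  simp only [c]
  push_cast
  module

theorem pwcScheme_eq_riemannQuad (hα : 0 < α) (f : E → E) (x₀ : E) {δ : ℝ} (hδ : 0 < δ) (n : ℕ) :
    pwcScheme α f x₀ δ n = x₀ + ((n * δ) ^ α / Real.Gamma (1 + α)) • f x₀ +
      riemannQuad α δ n (fun m => f (pwcScheme α f x₀ δ m)) := by
  rw [pwcScheme_eq, historySum_eq_riemannQuad hα hδ]

theorem pwcScheme_zero (hα : 0 < α) (f : E → E) (x₀ : E) (δ : ℝ) :
    pwcScheme α f x₀ δ 0 = x₀ := by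
  rw [pwcScheme_eq]
  simp [historySum, Real.zero_rpow hα.ne']

theorem pwcScheme_eq_adams (hα : 0 < α) (f : E → E) (x₀ : E) {δ : ℝ} (hδ : 0 < δ) (n : ℕ) :
    pwcScheme α f x₀ δ n = x₀ + ∑ m ∈ Finset.range n,
      (∫ s in (m * δ)..((m + 1) * δ), (n * δ - s) ^ (α - 1) / Real.Gamma α) •
        f (pwcScheme α f x₀ δ m) := by
  rw [pwcScheme_eq_riemannQuad hα f x₀ hδ n,
    ← smul_add_riemannQuad hα hδ n (fun m => f (pwcScheme α f x₀ δ m)),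
    pwcScheme_zero hα, add_assoc]

theorem uIcc_grid_subset {δ : ℝ} (hδ : 0 ≤ δ) {m n : ℕ} (hmn : m < n) :
    Set.uIcc (m * δ) ((m + 1) * δ) ⊆ Set.uIcc 0 (n * δ) := by
  have hm : (m + 1 : ℝ) ≤ n := by exact_mod_cast hmn
  have h0 : 0 ≤ (m : ℝ) * δ := by positivity
  rw [Set.uIcc_of_le (by nlinarith), Set.uIcc_of_le (by positivity)]
  exact Set.Icc_subset_Icc h0 (by gcongr)

theorem sum_integral_grid {F : Type*} [NormedAddCommGroup F] [NormedSpace ℝ F]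
    {h : ℝ → F} {δ : ℝ} (hδ : 0 ≤ δ) (n : ℕ)
    (hh : IntervalIntegrable h volume 0 (n * δ)) :
    (∀ m < n, IntervalIntegrable h volume (m * δ) ((m + 1) * δ)) ∧
    ∑ m ∈ Finset.range n, ∫ s in (m * δ)..((m + 1) * δ), h s = ∫ s in (0 : ℝ)..(n * δ), h s := by
  have hint : ∀ m < n, IntervalIntegrable h volume (m * δ) ((m + 1) * δ) := fun m hm =>
    hh.mono_set (uIcc_grid_subset hδ hm)
  refine ⟨hint, ?_⟩
  have h := intervalIntegral.sum_integral_adjacent_intervals (f := h) (μ := volume)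
    (a := fun m : ℕ => m * δ) (n := n) (fun m hm => by simpa using hint m hm)
  simpa using h

variable [FiniteDimensional ℝ E]

/-- On each cell the increment of `g` is the integral of `g'`, so the only error is the oscillation
of the kernel, at most `δ^α / Γ(1+α)`. -/
theorem norm_riemannQuad_sub_integral_le (hα₀ : 0 < α) (hα₁ : α < 1) {δ : ℝ} (hδ : 0 < δ) (n : ℕ)
    {g : ℝ → E} (hg : AbsolutelyContinuousOnInterval g 0 (n * δ)) :
    ‖riemannQuad α δ n (fun m => g (m * δ)) -
      ∫ s in (0 : ℝ)..(n * δ), ((n * δ - s) ^ α / Real.Gamma (1 + α)) • deriv g s‖ ≤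
    δ ^ α / Real.Gamma (1 + α) * ∫ s in (0 : ℝ)..(n * δ), ‖deriv g s‖ := by
  have hG : 0 < Real.Gamma (1 + α) := Real.Gamma_pos_of_pos (by linarith)
  have hφ := absolutelyContinuousOnInterval_fracPrimitive hα₀ (n * δ) 0 (n * δ)
  have hd := hg.intervalIntegrable_deriv'
  have hint : IntervalIntegrable
      (fun s => ((n * δ - s) ^ α / Real.Gamma (1 + α)) • deriv g s) volume 0 (n * δ) :=
    hd.continuousOn_smul hφ.continuousOn
  obtain ⟨hint', hsum⟩ := sum_integral_grid hδ.le n hint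
  obtain ⟨hd', -⟩ := sum_integral_grid hδ.le n hd
  obtain ⟨hnd', hnsum⟩ := sum_integral_grid hδ.le n hd.norm
  rw [riemannQuad_eq_sum_range hδ, ← hsum, ← hnsum, ← Finset.sum_sub_distrib, Finset.mul_sum]
  refine norm_sum_le_of_le _ fun m hm => ?_
  have hmn := Finset.mem_range.1 hm
  have hm' : (m + 1 : ℝ) ≤ n := by exact_mod_cast hmn
  have hle : m * δ ≤ (m + 1) * δ := by nlinarith
  have hgm : AbsolutelyContinuousOnInterval g (m * δ) ((m + 1) * δ) :=
    hg.mono (uIcc_grid_subset hδ.le hmn)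
  have hinc : g ((m + 1 : ℕ) * δ) - g (m * δ) = ∫ s in (m * δ)..((m + 1) * δ), deriv g s := by
    rw [hgm.integral_deriv_eq_sub']
    push_cast
    rfl
  have hconst : IntervalIntegrable
      (fun s => ((n * δ - (m + 1 : ℕ) * δ) ^ α / Real.Gamma (1 + α)) • deriv g s) volume
      (m * δ) ((m + 1) * δ) := (hd' m hmn).continuousOn_smul continuousOn_const
  rw [hinc, ← intervalIntegral.integral_smul,
    ← intervalIntegral.integral_sub hconst (hint' m hmn),
    ← intervalIntegral.integral_const_mul]
  refine intervalIntegral.norm_integral_le_of_norm_le hle (.of_forall fun s hs => ?_)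
    ((hnd' m hmn).const_mul _)
  have hb : 0 ≤ n * δ - (m + 1) * δ := by
    rw [← sub_mul]; exact mul_nonneg (by linarith) hδ.le
  rw [← sub_smul, norm_smul, ← sub_div, norm_div, Real.norm_of_nonneg hG.le]
  gcongr
  push_cast
  rw [Real.norm_eq_abs, abs_sub_comm, abs_of_nonneg (sub_nonneg.2
    (Real.rpow_le_rpow hb (by linarith [hs.2]) hα₀.le))]
  refine (rpow_sub_rpow_le_rpow_sub hα₀.le hα₁.le hb (by linarith [hs.2])).trans ?_
  exact Real.rpow_le_rpow (by linarith [hs.2]) (by linarith [hs.1]) hα₀.le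

theorem tendsto_riemannQuad (hα₀ : 0 < α) (hα₁ : α < 1) {t : ℝ} (ht : 0 < t) {g : ℝ → E}
    (hg : AbsolutelyContinuousOnInterval g 0 t) :
    Tendsto (fun n : ℕ => riemannQuad α (t / n) n (fun m => g (m * (t / n)))) atTop
      (𝓝 (∫ s in (0 : ℝ)..t, ((t - s) ^ α / Real.Gamma (1 + α)) • deriv g s)) := by
  rw [tendsto_iff_norm_sub_tendsto_zero]
  have hlim : Tendsto (fun n : ℕ => (t / n) ^ α / Real.Gamma (1 + α) *
      ∫ s in (0 : ℝ)..t, ‖deriv g s‖) atTop (𝓝 0) := by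
    have h := (((tendsto_const_div_atTop_nhds_zero_nat t).rpow_const
      (p := α) (Or.inr hα₀.le)).div_const (Real.Gamma (1 + α))).mul_const
      (∫ s in (0 : ℝ)..t, ‖deriv g s‖)
    simpa [Real.zero_rpow hα₀.ne'] using h
  refine squeeze_zero' (.of_forall fun _ => norm_nonneg _) ?_ hlim
  filter_upwards [eventually_gt_atTop 0] with n hn
  have hn' : (0 : ℝ) < n := by exact_mod_cast hn
  have hnt : (n : ℝ) * (t / n) = t := mul_div_cancel₀ _ hn'.ne'
  have h := norm_riemannQuad_sub_integral_le hα₀ hα₁ (div_pos ht hn') n (g := g)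
    (by rwa [hnt])
  rwa [hnt] at h

end scheme

/-! ### Convergence in an exponentially weighted norm. -/

section convergence

variable {α : ℝ}

theorem fracKernel_nonneg (hα : 0 < α) {t s : ℝ} (hs : s ≤ t) :
    0 ≤ (t - s) ^ (α - 1) / Real.Gamma α :=
  div_nonneg (Real.rpow_nonneg (sub_nonneg.2 hs) _) (Real.Gamma_pos_of_pos hα).le

/-- A truncation of the Laplace transform of `r^(α-1) / Γ(α)`, which equals `l^(-α)`. -/
theorem integral_fracKernel_mul_exp_le (hα : 0 < α) {l t : ℝ} (hl : 0 < l) (ht : 0 ≤ t) :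
    ∫ s in (0 : ℝ)..t, (t - s) ^ (α - 1) / Real.Gamma α * Real.exp (-(l * (t - s))) ≤
      (1 / l) ^ α := by
  have hG := Real.Gamma_pos_of_pos hα
  have hval := Real.integral_rpow_mul_exp_neg_mul_Ioi hα hl
  have hint : IntegrableOn (fun r : ℝ => r ^ (α - 1) * Real.exp (-(l * r))) (Set.Ioi 0) :=
    .of_integral_ne_zero (by rw [hval]; positivity)
  have hmono : ∫ r in Set.Ioc 0 t, r ^ (α - 1) * Real.exp (-(l * r)) ≤
      ∫ r in Set.Ioi 0, r ^ (α - 1) * Real.exp (-(l * r)) := by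
    refine setIntegral_mono_set hint ?_ Set.Ioc_subset_Ioi_self.eventuallyLE
    rw [EventuallyLE, ae_restrict_iff' measurableSet_Ioi]
    exact .of_forall fun r hr =>
      mul_nonneg (Real.rpow_nonneg (le_of_lt hr) _) (Real.exp_nonneg _)
  rw [intervalIntegral.integral_comp_sub_left
    (fun r => r ^ (α - 1) / Real.Gamma α * Real.exp (-(l * r))) t, sub_self, sub_zero,
    intervalIntegral.integral_of_le ht]
  simp only [div_mul_eq_mul_div]
  rw [integral_div, div_le_iff₀ hG, ← hval]
  exact hmono

/-- The exponential is increasing in `s`, so its value at the left end of a cell underestimates it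
there and the sum lies below the integral. -/
theorem sum_fracWeight_mul_exp_le (hα : 0 < α) {l δ : ℝ} (hl : 0 < l) (hδ : 0 < δ) (n : ℕ) :
    ∑ m ∈ Finset.range n,
      (∫ s in (m * δ)..((m + 1) * δ), (n * δ - s) ^ (α - 1) / Real.Gamma α) *
        Real.exp (-(l * (n * δ - m * δ))) ≤ (1 / l) ^ α := by
  have hint : IntervalIntegrable (fun s => (n * δ - s) ^ (α - 1) / Real.Gamma α *
      Real.exp (-(l * (n * δ - s)))) volume 0 (n * δ) :=
    (intervalIntegrable_fracKernel hα _ _ _).mul_continuousOn (by fun_prop)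
  obtain ⟨hint', hsum⟩ := sum_integral_grid hδ.le n hint
  refine le_trans ?_ (integral_fracKernel_mul_exp_le hα hl (t := n * δ) (by positivity))
  rw [← hsum]
  refine Finset.sum_le_sum fun m hm => ?_
  have hmn := Finset.mem_range.1 hm
  have hm' : (m + 1 : ℝ) ≤ n := by exact_mod_cast hmn
  have hle : (m + 1) * δ ≤ n * δ := by gcongr
  rw [← intervalIntegral.integral_mul_const]
  refine intervalIntegral.integral_mono_on (by nlinarith)
    ((intervalIntegrable_fracKernel hα _ _ _).mul_const _) (hint' m hmn) fun s hs => ?_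
  refine mul_le_mul_of_nonneg_left (Real.exp_le_exp.2 ?_)
    (fracKernel_nonneg hα (hs.2.trans hle))
  have := hs.1
  gcongr

theorem sum_fracWeight (hα : 0 < α) {δ : ℝ} (hδ : 0 < δ) (n : ℕ) :
    ∑ m ∈ Finset.range n,
      ∫ s in (m * δ)..((m + 1) * δ), (n * δ - s) ^ (α - 1) / Real.Gamma α =
      (n * δ) ^ α / Real.Gamma (1 + α) := by
  rw [(sum_integral_grid hδ.le n (intervalIntegrable_fracKernel hα _ _ _)).2,
    integral_fracKernel hα]
  simp [Real.zero_rpow hα.ne']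

variable {E : Type*} [NormedAddCommGroup E] [NormedSpace ℝ E]

theorem intervalIntegrable_fracKernel_smul (hα : 0 < α) (t : ℝ) {a b : ℝ} {g : ℝ → E}
    (hg : ContinuousOn g (Set.uIcc a b)) :
    IntervalIntegrable (fun s => ((t - s) ^ (α - 1) / Real.Gamma α) • g s) volume a b :=
  (intervalIntegrable_fracKernel hα t a b).smul_continuousOn hg

/-- The error bound for the scheme, as long as the bound stays below the radius `1` of the
neighbourhood of the solution on which the Lipschitz constant `L` is valid. -/
theorem norm_pwcScheme_sub_le [CompleteSpace E] (hα : 0 < α) {f : E → E} {x : ℝ → E} {T R l δ ε : ℝ}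
    {L : NNReal} (hLip : LipschitzOnWith L f (Metric.closedBall 0 (R + 1)))
    (hR : ∀ s ∈ Set.Icc 0 T, ‖x s‖ ≤ R) (hl : 0 < l) (hlL : L * (1 / l) ^ α ≤ 1 / 2)
    (hδ : 0 < δ) (hε : 0 ≤ ε)
    (hcont : ContinuousOn (fun s => f (x s)) (Set.Icc 0 T))
    (hmod : ∀ s ∈ Set.Icc 0 T, ∀ r ∈ Set.Icc 0 T, |s - r| ≤ δ → ‖f (x s) - f (x r)‖ ≤ ε)
    (heq : ∀ t ∈ Set.Icc 0 T,
      x t - x 0 = ∫ s in (0 : ℝ)..t, ((t - s) ^ (α - 1) / Real.Gamma α) • f (x s))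
    (hsmall : 2 * (ε * (T ^ α / Real.Gamma (1 + α))) * Real.exp (l * T) ≤ 1)
    (n : ℕ) (hn : n * δ ≤ T) :
    ‖pwcScheme α f (x 0) δ n - x (n * δ)‖ ≤
      2 * (ε * (T ^ α / Real.Gamma (1 + α))) * Real.exp (l * (n * δ)) := by
  set η := ε * (T ^ α / Real.Gamma (1 + α)) with hη
  have hG : 0 < Real.Gamma (1 + α) := Real.Gamma_pos_of_pos (by linarith)
  have hT : 0 ≤ T := le_trans (by positivity) hn
  have hη0 : 0 ≤ η := by positivity
  induction n using Nat.strong_induction_on with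
  | _ n ih =>
  have hnT : n * δ ∈ Set.Icc 0 T := ⟨by positivity, hn⟩
  have hsub : Set.uIcc 0 (n * δ) ⊆ Set.Icc 0 T := by
    rw [Set.uIcc_of_le hnT.1]; exact Set.Icc_subset_Icc_right hn
  obtain ⟨hint, hsum⟩ := sum_integral_grid hδ.le n
    (intervalIntegrable_fracKernel_smul hα (n * δ) (hcont.mono hsub))
  -- With exact weights, the error comes only from freezing `f` on each cell.
  have herr : pwcScheme α f (x 0) δ n - x (n * δ) = ∑ m ∈ Finset.range n,
      ∫ s in (m * δ)..((m + 1) * δ), ((n * δ - s) ^ (α - 1) / Real.Gamma α) •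
        (f (pwcScheme α f (x 0) δ m) - f (x s)) := by
    rw [pwcScheme_eq_adams hα f (x 0) hδ n, sub_eq_iff_eq_add.1 (heq _ hnT), ← hsum,
      add_comm _ (x 0), add_sub_add_left_eq_sub, ← Finset.sum_sub_distrib]
    refine Finset.sum_congr rfl fun m hm => ?_
    rw [← intervalIntegral.integral_smul_const, ← intervalIntegral.integral_sub
      (intervalIntegrable_fracKernel_smul hα _ continuousOn_const)
      (hint m (Finset.mem_range.1 hm))]
    simp only [smul_sub]
  have hterm : ∀ m ∈ Finset.range n,
      ‖∫ s in (m * δ)..((m + 1) * δ), ((n * δ - s) ^ (α - 1) / Real.Gamma α) •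
        (f (pwcScheme α f (x 0) δ m) - f (x s))‖ ≤
      (∫ s in (m * δ)..((m + 1) * δ), (n * δ - s) ^ (α - 1) / Real.Gamma α) *
        (L * (2 * η * Real.exp (l * (m * δ))) + ε) := by
    intro m hm
    have hmn := Finset.mem_range.1 hm
    have hm' : (m + 1 : ℝ) ≤ n := by exact_mod_cast hmn
    have hle : (m + 1) * δ ≤ n * δ := by gcongr
    have hm0 : 0 ≤ m * δ := by positivity
    have hmle : m * δ ≤ (m + 1) * δ := by nlinarith
    have hmT : m * δ ∈ Set.Icc 0 T := ⟨hm0, (hmle.trans hle).trans hn⟩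
    have he := ih m hmn hmT.2
    -- The bootstrap: the inductive bound and `hsmall` keep earlier values in the ball where `L` is
    -- valid.
    have he1 : ‖pwcScheme α f (x 0) δ m - x (m * δ)‖ ≤ 1 := by
      refine he.trans (le_trans ?_ hsmall)
      have := hmT.2
      gcongr
    have hX : pwcScheme α f (x 0) δ m ∈ Metric.closedBall (0 : E) (R + 1) := by
      rw [mem_closedBall_zero_iff]
      have := norm_le_norm_add_norm_sub' (pwcScheme α f (x 0) δ m) (x (m * δ))
      linarith [hR _ hmT]
    have hxm : x (m * δ) ∈ Metric.closedBall (0 : E) (R + 1) := by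
      rw [mem_closedBall_zero_iff]
      linarith [hR _ hmT]
    rw [← intervalIntegral.integral_mul_const]
    refine intervalIntegral.norm_integral_le_of_norm_le hmle (.of_forall fun s hs => ?_)
      ((intervalIntegrable_fracKernel hα _ _ _).mul_const _)
    have hk := fracKernel_nonneg hα (hs.2.trans hle)
    have hsT : s ∈ Set.Icc 0 T := ⟨hm0.trans hs.1.le, (hs.2.trans hle).trans hn⟩
    rw [norm_smul, Real.norm_of_nonneg hk]
    refine mul_le_mul_of_nonneg_left ?_ hk
    refine (norm_sub_le_norm_sub_add_norm_sub _ (f (x (m * δ))) _).trans (add_le_add ?_ ?_)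
    · exact (hLip.norm_sub_le hX hxm).trans (by gcongr)
    · refine hmod _ hmT _ hsT ?_
      rw [abs_sub_comm, abs_of_nonneg (by linarith [hs.1])]
      linarith [hs.2]
  rw [herr]
  have hexp : ∀ m : ℕ, Real.exp (l * (m * δ)) =
      Real.exp (-(l * (n * δ - m * δ))) * Real.exp (l * (n * δ)) := fun m => by
    rw [← Real.exp_add]; congr 1; ring
  calc _ ≤ _ := norm_sum_le_of_le _ hterm
    _ = 2 * η * Real.exp (l * (n * δ)) * (L * ∑ m ∈ Finset.range n,
          (∫ s in (m * δ)..((m + 1) * δ), (n * δ - s) ^ (α - 1) / Real.Gamma α) *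
            Real.exp (-(l * (n * δ - m * δ)))) +
        ε * ((n * δ) ^ α / Real.Gamma (1 + α)) := by
      rw [← sum_fracWeight hα hδ n, Finset.mul_sum, Finset.mul_sum, Finset.mul_sum,
        ← Finset.sum_add_distrib]
      refine Finset.sum_congr rfl fun m _ => ?_
      rw [hexp m]
      ring
    -- The choice of `l` halves the propagated error; the consistency error, at most `η`, fills the
    -- other half.
    _ ≤ 2 * η * Real.exp (l * (n * δ)) * (1 / 2) + η * Real.exp (l * (n * δ)) := by
      have h1 : (1 : ℝ) ≤ Real.exp (l * (n * δ)) := Real.one_le_exp (by positivity)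
      have h2 : ε * ((n * δ) ^ α / Real.Gamma (1 + α)) ≤ η := by rw [hη]; gcongr
      refine add_le_add (mul_le_mul_of_nonneg_left ?_ (by positivity))
        (h2.trans (le_mul_of_one_le_right hη0 h1))
      exact (mul_le_mul_of_nonneg_left (sum_fracWeight_mul_exp_le hα hl hδ n)
        L.coe_nonneg).trans hlL
    _ = 2 * η * Real.exp (l * (n * δ)) := by ring

theorem LocallyLipschitz.exists_lipschitzOnWith_closedBall [FiniteDimensional ℝ E] {f : E → E}
    (hf : LocallyLipschitz f) (R : ℝ) :
    ∃ L, LipschitzOnWith L f (Metric.closedBall 0 R) := by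
  have : ProperSpace E := FiniteDimensional.proper ℝ E
  exact hf.locallyLipschitzOn.exists_lipschitzOnWith_of_compact (isCompact_closedBall 0 R)

variable [FiniteDimensional ℝ E]

theorem LocallyLipschitz.comp_absolutelyContinuousOnInterval {f : E → E}
    (hf : LocallyLipschitz f) {x : ℝ → E} {a b : ℝ} (hx : AbsolutelyContinuousOnInterval x a b) :
    AbsolutelyContinuousOnInterval (fun s => f (x s)) a b := by
  obtain ⟨R, hR⟩ := hx.exists_bound
  obtain ⟨L, hL⟩ := hf.exists_lipschitzOnWith_closedBall R
  exact hL.comp_absolutelyContinuousOnInterval hx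
    fun s hs => mem_closedBall_zero_iff.2 (hR s hs)

theorem IsCaputoSolution.tendsto_pwcScheme (hα₀ : 0 < α) (hα₁ : α < 1) {f : E → E}
    (hf : LocallyLipschitz f) {x₀ : E} {T : ℝ} (hT : 0 < T) {x : ℝ → E}
    (hx : IsCaputoSolution α f x₀ T x) {t : ℝ} (ht : t ∈ Set.Ioc 0 T) :
    Tendsto (fun n : ℕ => pwcScheme α f x₀ (t / n) n) atTop (𝓝 (x t)) := by
  have : CompleteSpace E := FiniteDimensional.complete ℝ E
  obtain ⟨R, hR⟩ := hx.absCont.exists_bound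
  obtain ⟨L, hL⟩ := hf.exists_lipschitzOnWith_closedBall (R + 1)
  have hac := hf.comp_absolutelyContinuousOnInterval hx.absCont
  rw [Set.uIcc_of_le hT.le] at hR
  have huc := hac.uniformContinuousOn
  have hcont := hac.continuousOn
  rw [Set.uIcc_of_le hT.le] at huc hcont
  obtain ⟨l, hl, hlL⟩ : ∃ l : ℝ, 0 < l ∧ L * (1 / l) ^ α ≤ 1 / 2 := by
    have hpos : (0 : ℝ) < 2 * L + 1 := by positivity
    -- For this `l` the product is `L / (2L+1)`.
    refine ⟨(2 * L + 1) ^ α⁻¹, by positivity, ?_⟩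
    rw [one_div, Real.inv_rpow (by positivity), Real.rpow_inv_rpow hpos.le hα₀.ne',
      ← div_eq_mul_inv, div_le_iff₀ hpos]
    linarith
  have hG : 0 < Real.Gamma (1 + α) := Real.Gamma_pos_of_pos (by linarith)
  rw [Metric.tendsto_atTop]
  intro e he
  set C := T ^ α / Real.Gamma (1 + α) * Real.exp (l * T) with hC
  have hC0 : 0 < C := by positivity
  -- Makes the final bound at time `T` equal to `min 1 (e / 2)`: `1` for the bootstrap radius, `e /
  -- 2` for a strict inequality.
  set ε := min 1 (e / 2) / (2 * C) with hεdef
  have hε : 0 < ε := div_pos (lt_min one_pos (half_pos he)) (by positivity)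
  have hεC : 2 * (ε * (T ^ α / Real.Gamma (1 + α))) * Real.exp (l * T) = min 1 (e / 2) := by
    have : 2 * (ε * (T ^ α / Real.Gamma (1 + α))) * Real.exp (l * T) = ε * (2 * C) := by
      rw [hC]; ring
    rw [this, hεdef, div_mul_cancel₀ _ (by positivity)]
  obtain ⟨d, hd, hmod⟩ := Metric.uniformContinuousOn_iff.1 huc ε hε
  obtain ⟨N, hN⟩ := (Metric.tendsto_atTop.1 (tendsto_const_div_atTop_nhds_zero_nat t)) d hd
  refine ⟨max N 1, fun n hn => ?_⟩
  have hn0 : (0 : ℝ) < n := by exact_mod_cast (le_max_right N 1).trans hn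
  have hδ : 0 < t / n := div_pos ht.1 hn0
  have hδd : t / n < d := by
    have := hN n ((le_max_left N 1).trans hn)
    rwa [Real.dist_eq, sub_zero, abs_of_pos hδ] at this
  have hnt : (n : ℝ) * (t / n) = t := mul_div_cancel₀ _ hn0.ne'
  have h := norm_pwcScheme_sub_le hα₀ hL hR hl hlL hδ hε.le hcont
    (fun s hs r hr hsr => by
      rw [← dist_eq_norm]
      exact (hmod s hs r hr (by rw [Real.dist_eq]; exact hsr.trans_lt hδd)).le)
    (fun r hr => hx.sub_eq_fracIntegral hα₀ hα₁ hr) (hεC.trans_le (min_le_left _ _)) n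
    (by rw [hnt]; exact ht.2)
  rw [hnt, hx.init] at h
  rw [dist_eq_norm]
  have hlt : 2 * (ε * (T ^ α / Real.Gamma (1 + α))) * Real.exp (l * t) ≤ e / 2 := by
    refine le_trans ?_ (hεC.trans_le (min_le_right _ _))
    have := ht.2
    gcongr
  linarith

end convergence

theorem mainTheorem2 {E : Type*} [NormedAddCommGroup E] [NormedSpace ℝ E]
    [FiniteDimensional ℝ E] (α : ℝ) (hα₀ : 0 < α) (hα₁ : α < 1)
    (f : E → E) (hf : LocallyLipschitz f) (x₀ : E) (T : ℝ) (hT : 0 < T)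
    (x : ℝ → E) (hx : IsCaputoSolution α f x₀ T x) :
    -- the fractionally integrated equation
    (∀ t ∈ Set.Icc 0 T,
      IntervalIntegrable (fun s => ((t - s) ^ (α - 1) / Real.Gamma α) • f (x s)) volume 0 t ∧
      x t - x 0 = ∫ s in (0 : ℝ)..t, ((t - s) ^ (α - 1) / Real.Gamma α) • f (x s)) ∧
    -- its integrated-by-parts form
    AbsolutelyContinuousOnInterval (fun s => f (x s)) 0 T ∧
    (∀ t ∈ Set.Icc 0 T,
      IntervalIntegrable
        (fun s => ((t - s) ^ α / Real.Gamma (1 + α)) • deriv (fun r => f (x r)) s) volume 0 t ∧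
      x t = x 0 + (t ^ α / Real.Gamma (1 + α)) • f (x 0) +
        ∫ s in (0 : ℝ)..t,
          ((t - s) ^ α / Real.Gamma (1 + α)) • deriv (fun r => f (x r)) s) ∧
    -- convergence of the scheme as `δt = t / n → 0` with `t = n δt` fixed
    (∀ t ∈ Set.Ioc 0 T,
      Tendsto (fun n : ℕ => pwcScheme α f x₀ (t / n) n) atTop (𝓝 (x t))) ∧
    -- convergence of the history sum of the scheme to the integral
    (∀ t ∈ Set.Ioc 0 T,
      Tendsto (fun n : ℕ =>
          historySum α (t / n) n (fun m => f (pwcScheme α f x₀ (t / n) m))) atTop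
        (𝓝 (∫ s in (0 : ℝ)..t,
          ((t - s) ^ α / Real.Gamma (1 + α)) • deriv (fun r => f (x r)) s))) ∧
    -- the scheme is the integrated-by-parts equation with its integral replaced by a quadrature
    (∀ δ : ℝ, 0 < δ → ∀ n : ℕ,
      pwcScheme α f x₀ δ n = x₀ + ((n * δ) ^ α / Real.Gamma (1 + α)) • f x₀ +
        riemannQuad α δ n (fun m => f (pwcScheme α f x₀ δ m))) ∧
    -- and that quadrature is convergent
    (∀ t : ℝ, 0 < t → ∀ g : ℝ → E, AbsolutelyContinuousOnInterval g 0 t →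
      Tendsto (fun n : ℕ => riemannQuad α (t / n) n (fun m => g (m * (t / n)))) atTop
        (𝓝 (∫ s in (0 : ℝ)..t, ((t - s) ^ α / Real.Gamma (1 + α)) • deriv g s))) ∧
    -- fractional Adams form: the explicit rectangle rule for the fractional integral
    (∀ δ : ℝ, 0 < δ → ∀ n : ℕ,
      pwcScheme α f x₀ δ n = x₀ + ∑ m ∈ Finset.range n,
        (∫ s in (m * δ)..((m + 1) * δ), (n * δ - s) ^ (α - 1) / Real.Gamma α) •
          f (pwcScheme α f x₀ δ m)) := by
  have hac := hf.comp_absolutelyContinuousOnInterval hx.absCont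
  have hac' : ∀ t ∈ Set.Icc 0 T, AbsolutelyContinuousOnInterval (fun s => f (x s)) 0 t :=
    fun t ht => hac.mono (by
      rw [Set.uIcc_of_le ht.1, Set.uIcc_of_le hT.le]; exact Set.Icc_subset_Icc_right ht.2)
  have hparts : ∀ t ∈ Set.Icc 0 T, x t = x 0 + (t ^ α / Real.Gamma (1 + α)) • f (x 0) +
      ∫ s in (0 : ℝ)..t, ((t - s) ^ α / Real.Gamma (1 + α)) • deriv (fun r => f (x r)) s := by
    intro t ht
    rw [integral_fracPrimitive_smul_deriv hα₀ ht.1 (hac' t ht),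
      ← hx.sub_eq_fracIntegral hα₀ hα₁ ht]
    abel
  refine ⟨fun t ht => ⟨?_, hx.sub_eq_fracIntegral hα₀ hα₁ ht⟩, hac,
    fun t ht => ⟨?_, hparts t ht⟩, fun t ht => hx.tendsto_pwcScheme hα₀ hα₁ hf hT ht,
    fun t ht => ?_, fun δ hδ n => pwcScheme_eq_riemannQuad hα₀ f x₀ hδ n,
    fun t ht g hg => tendsto_riemannQuad hα₀ hα₁ ht hg,
    fun δ hδ n => pwcScheme_eq_adams hα₀ f x₀ hδ n⟩
  · exact intervalIntegrable_fracKernel_smul hα₀ t (hac' t ht).continuousOn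
  · exact (hac' t ht).intervalIntegrable_deriv'.continuousOn_smul
      (absolutelyContinuousOnInterval_fracPrimitive hα₀ t 0 t).continuousOn
  -- Since `n * (t / n) = t`, the non-history terms of the scheme do not depend on `n ≥ 1` and match
  -- those of (∗); subtracting them leaves the history sum and its limit.
  · have hlim := (hx.tendsto_pwcScheme hα₀ hα₁ hf hT ht).sub_const
      (x₀ + (t ^ α / Real.Gamma (1 + α)) • f x₀)
    have hval := hparts t (Set.Ioc_subset_Icc_self ht)
    rw [hx.init] at hval
    rw [← sub_eq_iff_eq_add'.2 hval]
    refine hlim.congr' ?_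
    filter_upwards [eventually_gt_atTop 0] with n hn
    have hn0 : (n : ℝ) ≠ 0 := by exact_mod_cast hn.ne'
    rw [sub_eq_iff_eq_add', pwcScheme_eq, mul_div_cancel₀ _ hn0]
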